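/- Let $G=(V,E)$ be a directed graph with finitely many links (parallel links allowed), let $s,d\in V$ be a source and a destination, and let $\mathcal P$ be the set of loop-free paths from $s$ to $d$, each path being identified with its set of links. For $\theta=(\theta_i)_{i\in E}\in(0,1]^E$, the delay of a packet on link $i$ is geometric with success probability $\theta_i$ (values in $\{1,2,\dots\}$), delays being independent over links and packets. Let $\psi_\theta^p$ be the distribution of the end-to-end delay on $p\in\mathcal P$, i.e. of the sum of the delays of the links of $p$, let $h(p)$ be the number of links of $p$, and let $D_\theta(p)=\sum_{i\in p}1/\theta_i$ be its mean. A (possibly randomized) source-routing policy $\pi$ with bandit feedback ($\pi\in\Pi_1$) selects the path $p^\pi(n)$ of the $n$-th packet on the basis of the previously selected paths $p^\pi(1),\dots,p^\pi(n-1)$ and the end-to-end delays $D^\pi(1),\dots,D^\pi(n-1)$ observed on them. It is *uniformly good* if for every parameter $\theta\in(0,1]^E$ and every $\alpha>0$, the expected number, under $\theta$, of packets among the first $n$ that are sent on a path $p$ with $D_\theta(p)>\min_{q\in\mathcal P} D_\theta(q)$ is $o(n^\alpha)$ as $n\to\infty$. Theorem. Let $\theta\in(0,1]^E$ be such that the optimal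 path $p^\star\in\arg\min_{p\in\mathcal P}D_\theta(p)$ is unique, let $\Delta_p=D_\theta(p)-D_\theta(p^\star)$, and let $R^\pi(N)=\mathbb E_\theta\bigl[\sum_{n=1}^N D^\pi(n)\bigr]-N D_\theta(p^\star)$ be the regret. Then every uniformly good policy $\pi\in\Pi_1$ satisfies $$\liminf_{N\to\infty}\frac{R^\pi(N)}{\log N}\ \ge\ C_1(\theta),$$ where $C_1(\theta)$ is the infimum of $\sum_{p\in\mathcal P}x_p\Delta_p$ over all $x=(x_p)_{p\in\mathcal P}\in[0,\infty)^{\mathcal P}$ such that $$\inf_{\lambda\in B_1(\theta)}\ \sum_{p\ne p^\star}x_p\sum_{k=h(p)}^\infty\psi_\theta^p(k)\log\frac{\psi_\theta^p(k)}{\psi_\lambda^p(k)}\ \ge\ 1 .$$ Here the inner sum is the Kullback-Leibler divergence of $\psi_\theta^p$ from $\psi_\lambda^p$, with values in $[0,\infty]$; $0\cdot\infty=0$, $\inf\emptyset=+\infty$; and $B_1(\theta)$ is the set of $\lambda\in(0,1]^E$ such that the multisets $\{\lambda_i:i\in p^\star\}$ and $\{\theta_i:i\in p^\star\}$ are equal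 and $\min_{p\in\mathcal P}D_\lambda(p)<D_\lambda(p^\star)$. -/

import Mathlib

open MeasureTheory ProbabilityTheory Filter InformationTheory
open scoped NNReal ENNReal

noncomputable section

/-- A directed network with node set `V` and link set `E` (parallel links are allowed), together
with a source-destination pair. -/
structure Network (V E : Type*) where
  /-- the node where a link starts -/
  tail : E → V
  /-- the node where a link ends -/
  head : E → V
  /-- the source -/
  src : V
  /-- the destination -/
  dst : V

namespace Network

variable {V E : Type*}

/-- `G.IsWalk u l v`: the links of `l`, taken in this order, lead from the node `u` to `v`. -/
def IsWalk (G : Network V E) : V → List E → V → Prop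
  | u, [], v => u = v
  | u, e :: l, v => G.tail e = u ∧ G.IsWalk (G.head e) l v

/-- The set of links `p` is a loop-free path from the source to the destination: its links can be
listed as a walk from the source to the destination that visits no node twice. -/
def IsLoopFreePath (G : Network V E) (p : Finset E) : Prop :=
  ∃ l : List E, G.IsWalk G.src l G.dst ∧ (G.src :: l.map G.head).Nodup ∧ ∀ e, e ∈ p ↔ e ∈ l

/-- The set `𝒫` of loop-free paths from the source to the destination, each path being identified
with the set of its links. -/
def Path (G : Network V E) : Type _ := {p : Finset E // G.IsLoopFreePath p}

instance [Finite E] (G : Network V E) : Finite G.Path := by unfold Path; infer_instance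

instance [Finite E] (G : Network V E) : Fintype G.Path := Fintype.ofFinite _

/-- The set of links of a path. -/
def Path.links {G : Network V E} (p : G.Path) : Finset E := p.1

end Network

/-- Network parameters: each link `i` has a success probability `θ i ∈ (0, 1]`. -/
abbrev Params (E : Type*) : Type _ := E → Set.Ioc (0 : ℝ) 1

/-- The geometric delay distribution on `{1, 2, …}` of a link with success probability `t`.
(`geometricMeasure` counts the failures before the first success.) -/
def linkDelay (t : Set.Ioc (0 : ℝ) 1) : Measure ℕ :=
  (geometricMeasure ⟨t.1, t.2.1.le, t.2.2⟩).map (fun k => k + 1)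

instance (t : Set.Ioc (0 : ℝ) 1) : IsProbabilityMeasure (linkDelay t) :=
  Measure.isProbabilityMeasure_map (by fun_prop)

namespace Network

variable {V E : Type*} [Fintype E] {G : Network V E}

/-- The distribution `ψ_θ^p` of the end-to-end delay of a packet sent on the path `p`: the law of
the sum over the links of `p` of independent link delays. -/
def pathDelay (θ : Params E) (p : G.Path) : Measure ℕ :=
  (Measure.pi fun i => linkDelay (θ i)).map (fun d => ∑ i ∈ p.links, d i)

instance (θ : Params E) (p : G.Path) : IsProbabilityMeasure (pathDelay θ p) :=
  Measure.isProbabilityMeasure_map (Measurable.of_discrete).aemeasurable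

/-- The average packet delay `D_θ(p) = ∑_{i ∈ p} 1 / θ_i`. -/
def avgDelay (θ : Params E) (p : G.Path) : ℝ := ∑ i ∈ p.links, 1 / (θ i : ℝ)

/-- The path `p` is sub-optimal under `θ`. -/
def IsSuboptimal (θ : Params E) (p : G.Path) : Prop := ∃ q : G.Path, avgDelay θ q < avgDelay θ p

/-- The bandit feedback of `n` packets: for each of them the chosen path and the observed
end-to-end delay. -/
abbrev History (G : Network V E) (n : ℕ) : Type _ := Fin n → G.Path × ℕ

/-- A (possibly randomized) source-routing policy with bandit feedback: given the paths and the
end-to-end delays of the `n` previous packets, it prescribes the law of the path of the next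
packet. -/
abbrev BanditPolicy (G : Network V E) : Type _ := (n : ℕ) → G.History n → PMF G.Path

/-- The law of the first `n` paths and end-to-end delays under the policy `π` and parameters `θ`:
given the past, the next path `p` is drawn by the policy, and then its delay from `ψ_θ^p`. -/
def historyLaw (π : G.BanditPolicy) (θ : Params E) : (n : ℕ) → PMF (G.History n)
  | 0 => PMF.pure Fin.elim0
  | n + 1 => (historyLaw π θ n).bind fun h =>
      (π n h).bind fun p => (pathDelay θ p).toPMF.map fun k => Fin.snoc h (p, k)

/-- The expectation of a nonnegative function of the first `n` paths and delays. -/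
def expect (π : G.BanditPolicy) (θ : Params E) (n : ℕ) (f : G.History n → ℝ≥0∞) : ℝ≥0∞ :=
  ∑' h, historyLaw π θ n h * f h

/-- The expected number of sub-optimal paths among the paths of the first `n` packets. -/
def expectedSuboptimal (π : G.BanditPolicy) (θ : Params E) (n : ℕ) : ℝ≥0∞ :=
  expect π θ n fun h => ({j | IsSuboptimal θ (h j).1} : Set (Fin n)).ncard

/-- Uniformly good policies: for all parameters and all `α > 0`, the expected number of selections
of sub-optimal paths up to the `n`-th packet (a number in `[0, n]`) is `o(n ^ α)`. -/
def UniformlyGood (π : G.BanditPolicy) : Prop :=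
  ∀ θ : Params E, ∀ α : ℝ, 0 < α →
    (fun n : ℕ => (expectedSuboptimal π θ n).toReal) =o[atTop] fun n : ℕ => (n : ℝ) ^ α

/-- The regret `R^π(N) = 𝔼[∑_{n ≤ N} D^π(n)] - N D_θ(p⋆)`. -/
def regret (π : G.BanditPolicy) (θ : Params E) (pstar : G.Path) (N : ℕ) : EReal :=
  (expect π θ N (fun h => ∑ j, ((h j).2 : ℝ≥0∞)) : EReal) -
    ((N * avgDelay θ pstar : ℝ) : EReal)

/-- The set `B₁(θ)` of bad parameters: the multiset of the parameters on `p⋆` is that of `θ`, and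
`p⋆` is not optimal. -/
def badSet (θ : Params E) (pstar : G.Path) : Set (Params E) :=
  {lam | pstar.links.val.map lam = pstar.links.val.map θ ∧
    ∃ p : G.Path, avgDelay lam p < avgDelay lam pstar}

open scoped Classical in
/-- The constraint of the optimization problem:
`inf_{λ ∈ B₁(θ)} ∑_{p ≠ p⋆} x_p KL(ψ_θ^p, ψ_λ^p) ≥ 1`, in `[0, ∞]`. -/
def Feasible (θ : Params E) (pstar : G.Path) (x : G.Path → ℝ≥0) : Prop :=
  1 ≤ ⨅ lam ∈ badSet θ pstar, ∑ p ∈ Finset.univ.erase pstar,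
    (x p : ℝ≥0∞) * klDiv (pathDelay θ p) (pathDelay lam p)

/-- `C₁(θ)`: the infimum of `∑_p x_p Δ_p` over the feasible `x ≥ 0`, where
`Δ_p = D_θ(p) - D_θ(p⋆)`. -/
def lowerBoundConst (θ : Params E) (pstar : G.Path) : EReal :=
  ⨅ (x : G.Path → ℝ≥0) (_ : Feasible θ pstar x),
    ((∑ p, (x p : ℝ) * (avgDelay θ p - avgDelay θ pstar) : ℝ) : EReal)

end Network

end

/-! This is a change-of-measure argument in the style of Lai–Robbins and Graves–Lai. Let `λ` be a
bad parameter. A uniformly good policy sends almost all packets on `p⋆` under `θ` and few under `λ`,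
so histories distinguish the two parameters. By the testing inequality `exp_neg_half_le_of_hasSum`,
the expected log-likelihood ratio of `N` packets is then at least `(1 - α) log N - O(1)` for every
`α > 0`. The choices of the policy cancel in this ratio, so Wald's identity (`hasSum_sum_history`)
turns its expectation into `∑ p, T_p(N) KL(ψ_θ^p, ψ_λ^p)`, with `T_p(N)` the expected number of uses
of `p`. The path `p⋆` contributes nothing: the law of its delay depends only on the multiset of its
parameters.

The argument needs finite divergences, which can fail when all links of a path have `λ i = 1`.
Lowering to `s < 1` the parameters equal to `1` off `p⋆` (`perturb`) repairs this, because every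
other path has a link off `p⋆`. Each divergence grows by at most `h(p) log (1 / s)`, and `λ` stays
bad for `s` near `1`.

The regret is `∑ p, T_p(N) Δ_p`. If its liminf were too small, the vectors `T_p(N) / log N`, `p ≠
p⋆`, would be bounded along a subsequence. A limit point is feasible
(`UniformlyGood.feasible_of_tendsto`) and costs less than `C₁(θ)`, a contradiction. -/

noncomputable section

namespace Network

/-! ### Loop-free paths are pairwise incomparable as sets of links -/

section Walks

variable {V E : Type*} {G : Network V E}

theorem IsWalk.end_mem {l : List E} {u v : V} (h : G.IsWalk u l v) : v ∈ u :: l.map G.head := by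
  induction l generalizing u with
  | nil => simp only [IsWalk] at h; simp [h]
  | cons e l ih => exact List.mem_cons_of_mem _ (ih h.2)

theorem IsWalk.tail_mem {l : List E} {u v : V} (h : G.IsWalk u l v) {e : E} (he : e ∈ l) :
    G.tail e ∈ u :: l.map G.head := by
  induction l generalizing u with
  | nil => simp at he
  | cons f l ih =>
    rcases List.mem_cons.1 he with rfl | he
    · simp [h.1]
    · exact List.mem_cons_of_mem _ (ih h.2 he)

/-- Both walks are followed together. The only link of `l'` that leaves `u` is its first one, since
another would make `l'` revisit `u`; so `l` must start with the same link. -/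
theorem IsWalk.eq_of_subset {l' l : List E} {u v : V} (h' : G.IsWalk u l' v)
    (hn' : (u :: l'.map G.head).Nodup) (h : G.IsWalk u l v) (hn : (u :: l.map G.head).Nodup)
    (hsub : ∀ e ∈ l, e ∈ l') : l = l' := by
  induction l' generalizing u l with
  | nil => exact List.eq_nil_iff_forall_not_mem.2 fun e he => by simpa using hsub e he
  | cons e l' ih =>
    have hu : u ∉ G.head e :: l'.map G.head := (List.nodup_cons.1 hn').1
    cases l with
    | nil =>
      have huv : u = v := h
      exact absurd (huv ▸ h'.2.end_mem) hu
    | cons f l =>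
      have hfe : f = e := by
        rcases List.mem_cons.1 (hsub f List.mem_cons_self) with hf | hf
        · exact hf
        · exact absurd (h.1 ▸ h'.2.tail_mem hf) hu
      subst hfe
      have hn2 := (List.nodup_cons.1 hn).2
      rw [ih h'.2 (List.nodup_cons.1 hn').2 h.2 hn2]
      intro e he
      rcases List.mem_cons.1 (hsub e (List.mem_cons_of_mem _ he)) with rfl | h1
      · exact absurd (List.mem_map_of_mem he) (List.nodup_cons.1 hn2).1
      · exact h1

/-- A loop-free path is not properly contained in another one. -/
theorem Path.exists_link_notMem {p q : G.Path} (hpq : p ≠ q) : ∃ i ∈ p.links, i ∉ q.links := by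
  by_contra! hsub
  obtain ⟨l, hw, hn, hl⟩ := p.2
  obtain ⟨l', hw', hn', hl'⟩ := q.2
  have : l = l' := hw'.eq_of_subset hn' hw hn fun e he => (hl' e).1 (hsub e ((hl e).2 he))
  subst this
  exact hpq (Subtype.ext (Finset.ext fun e => (hl e).trans (hl' e).symm))

end Walks

end Network

open scoped Classical in
theorem ncard_setOf_eq_sum {ι : Type*} [Fintype ι] (P : ι → Prop) :
    {j | P j}.ncard = ∑ j, if P j then 1 else 0 := by
  rw [Set.ncard_eq_toFinset_card', Finset.sum_boole]
  simp

theorem PMF.tsum_bind_mul {α β : Type*} (p : PMF α) (f : α → PMF β) (F : β → ℝ≥0∞) :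
    ∑' b, (p.bind f) b * F b = ∑' a, p a * ∑' b, f a b * F b := by
  simp_rw [PMF.bind_apply, ← ENNReal.tsum_mul_right]
  rw [ENNReal.tsum_comm]
  simp_rw [mul_assoc, ENNReal.tsum_mul_left]

theorem PMF.tsum_map_mul {α β : Type*} (p : PMF α) (f : α → β) (F : β → ℝ≥0∞) :
    ∑' b, (p.map f) b * F b = ∑' a, p a * F (f a) := by
  rw [PMF.map, PMF.tsum_bind_mul]
  refine tsum_congr fun a => ?_
  congr 1
  rw [tsum_eq_single (f a)]
  · simp
  · intro b hb; simp [hb]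

namespace Network

variable {V E : Type*} [Fintype E] {G : Network V E}

/-! ### Laws of histories, Wald's identity and change of measure -/

section Policies

variable (π : G.BanditPolicy) (θ : Params E)

theorem expect_zero (f : G.History 0 → ℝ≥0∞) : expect π θ 0 f = f Fin.elim0 := by
  unfold expect
  rw [tsum_eq_single Fin.elim0]
  · simp [historyLaw]
  · intro b hb; exact absurd (Subsingleton.elim _ _) hb

theorem expect_succ (n : ℕ) (f : G.History (n + 1) → ℝ≥0∞) :
    expect π θ (n + 1) f = expect π θ n fun h =>
      ∑ p, π n h p * ∫⁻ k, f (Fin.snoc h (p, k)) ∂(pathDelay θ p) := by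
  unfold expect
  rw [historyLaw, PMF.tsum_bind_mul]
  refine tsum_congr fun h => ?_
  rw [PMF.tsum_bind_mul, tsum_fintype]
  simp_rw [PMF.tsum_map_mul, lintegral_countable', Measure.toPMF_apply, mul_comm]

theorem expect_add (n : ℕ) (f g : G.History n → ℝ≥0∞) :
    expect π θ n (fun h => f h + g h) = expect π θ n f + expect π θ n g := by
  simp [expect, mul_add, ENNReal.tsum_add]

theorem expect_sum {ι : Type*} (s : Finset ι) (n : ℕ) (f : ι → G.History n → ℝ≥0∞) :
    expect π θ n (fun h => ∑ i ∈ s, f i h) = ∑ i ∈ s, expect π θ n (f i) := by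
  classical
  induction s using Finset.induction_on with
  | empty => simp [expect]
  | insert a s ha ih => simp only [Finset.sum_insert ha, expect_add, ih]

theorem expect_mul_const (n : ℕ) (f : G.History n → ℝ≥0∞) (c : ℝ≥0∞) :
    expect π θ n (fun h => f h * c) = expect π θ n f * c := by
  simp only [expect, ← ENNReal.tsum_mul_right, mul_assoc]

theorem expect_const (n : ℕ) (c : ℝ≥0∞) : expect π θ n (fun _ => c) = c := by
  simp [expect, ENNReal.tsum_mul_right, PMF.tsum_coe]

/-- The expected number of selections of the path `p` among the first `n` packets. -/
def plays (p : G.Path) (n : ℕ) : ℝ≥0∞ := ∑ j ∈ Finset.range n, expect π θ j fun h => π j h p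

/-- Wald's identity for additive functionals of the history. -/
theorem expect_sum_history (g : G.Path → ℕ → ℝ≥0∞) (n : ℕ) :
    expect π θ n (fun h => ∑ j, g (h j).1 (h j).2) =
      ∑ p, plays π θ p n * ∫⁻ k, g p k ∂(pathDelay θ p) := by
  induction n with
  | zero => simp [expect_zero, plays]
  | succ n ih =>
    have key : ∀ h : G.History n,
        ∑ p, π n h p * ∫⁻ k, ∑ j, g ((Fin.snoc h (p, k) : G.History (n + 1)) j).1
          ((Fin.snoc h (p, k) : G.History (n + 1)) j).2 ∂(pathDelay θ p) =
        ∑ j, g (h j).1 (h j).2 + ∑ p, π n h p * ∫⁻ k, g p k ∂(pathDelay θ p) := by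
      intro h
      -- The past terms do not depend on the new packet, so they come out with total weight `1`.
      have h1 : ∑ p, π n h p = 1 := by rw [← tsum_fintype (L := .unconditional _), PMF.tsum_coe]
      simp only [Fin.sum_univ_castSucc, Fin.snoc_castSucc, Fin.snoc_last]
      simp_rw [lintegral_add_left (measurable_const), lintegral_const, measure_univ, mul_one,
        mul_add, Finset.sum_add_distrib, ← Finset.sum_mul, h1, one_mul]
    rw [expect_succ]
    simp_rw [key, expect_add, ih, expect_sum, expect_mul_const, plays, Finset.sum_range_succ,
      add_mul, Finset.sum_add_distrib]

theorem sum_plays (n : ℕ) : ∑ p, plays π θ p n = n := by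
  have := expect_sum_history π θ (fun _ _ => 1) n
  simpa [expect_const] using this.symm

theorem plays_ne_top (p : G.Path) (n : ℕ) : plays π θ p n ≠ ∞ := by
  refine ne_top_of_le_ne_top (ENNReal.natCast_ne_top n) ?_
  rw [← sum_plays π θ n]
  exact Finset.single_le_sum (f := fun p => plays π θ p n) (fun _ _ => zero_le)
    (Finset.mem_univ p)

open scoped Classical in
theorem expectedSuboptimal_eq (n : ℕ) :
    expectedSuboptimal π θ n = ∑ p with IsSuboptimal θ p, plays π θ p n := by
  have := expect_sum_history π θ (fun p _ => if IsSuboptimal θ p then 1 else 0) n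
  simp only [lintegral_const, measure_univ, mul_one, mul_ite, mul_zero] at this
  rw [Finset.sum_filter, ← this]
  unfold expectedSuboptimal
  congr 1
  ext h
  rw [ncard_setOf_eq_sum]
  push_cast
  rfl

theorem expectedSuboptimal_ne_top (n : ℕ) : expectedSuboptimal π θ n ≠ ∞ := by
  classical
  rw [expectedSuboptimal_eq]
  exact ENNReal.sum_ne_top.2 fun p _ => plays_ne_top π θ p n

/-- A history extends exactly one shorter history by one pair, so each sum in the binds collapses to
a single term. The policy factor does not involve `θ`. -/
theorem historyLaw_succ (n : ℕ) (h : G.History (n + 1)) :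
    historyLaw π θ (n + 1) h = historyLaw π θ n (Fin.init h) *
      (π n (Fin.init h) (h (Fin.last n)).1 *
        pathDelay θ (h (Fin.last n)).1 {(h (Fin.last n)).2}) := by
  have hne : ∀ (g : G.History n) (x : G.Path × ℕ), h = Fin.snoc g x →
      g = Fin.init h ∧ x = h (Fin.last n) := by
    rintro g x rfl; simp
  rw [historyLaw, PMF.bind_apply, tsum_eq_single (Fin.init h)]
  · rw [PMF.bind_apply, tsum_eq_single (h (Fin.last n)).1]
    · rw [PMF.map_apply, tsum_eq_single (h (Fin.last n)).2]
      · simp [Measure.toPMF_apply]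
      · intro k hk
        rw [if_neg]
        intro hh
        exact hk (congrArg Prod.snd (hne _ _ hh).2)
    · intro p hp
      rw [PMF.map_apply, ENNReal.tsum_eq_zero.2, mul_zero]
      intro k
      rw [if_neg]
      intro hh
      exact hp (congrArg Prod.fst (hne _ _ hh).2)
  · intro g hg
    rw [PMF.bind_apply, ENNReal.tsum_eq_zero.2, mul_zero]
    intro p
    rw [PMF.map_apply, ENNReal.tsum_eq_zero.2, mul_zero]
    intro k
    rw [if_neg]
    intro hh
    exact hg (hne _ _ hh).1

/-- Change of measure: the likelihood ratio of a history is the product of those of its delays. -/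
theorem historyLaw_mul_exp_le (lam : Params E) (r : G.Path → ℕ → ℝ)
    (hr : ∀ p k, pathDelay θ p {k} * ENNReal.ofReal (Real.exp (-r p k)) ≤ pathDelay lam p {k})
    (n : ℕ) (h : G.History n) :
    historyLaw π θ n h * ENNReal.ofReal (Real.exp (-∑ j, r (h j).1 (h j).2)) ≤
      historyLaw π lam n h := by
  induction n with
  | zero => simp [historyLaw]
  | succ n ih =>
    rw [historyLaw_succ, historyLaw_succ, Fin.sum_univ_castSucc, neg_add, Real.exp_add,
      ENNReal.ofReal_mul (Real.exp_nonneg _)]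
    calc _ = (historyLaw π θ n (Fin.init h) * ENNReal.ofReal (Real.exp
            (-∑ j, r (Fin.init h j).1 (Fin.init h j).2))) * (π n (Fin.init h) (h (Fin.last n)).1 *
          (pathDelay θ (h (Fin.last n)).1 {(h (Fin.last n)).2} *
            ENNReal.ofReal (Real.exp (-r (h (Fin.last n)).1 (h (Fin.last n)).2)))) := by
          simp only [Fin.init]; ring
      _ ≤ _ := by
          gcongr
          · exact ih _
          · exact hr _ _

end Policies

end Network

/-- A testing inequality in the spirit of Bretagnolle and Huber. If `p` and `q` are probability
mass functions with log-likelihood ratio `L`, whose mean under `p` is `m`, and of any two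
nonnegative statistics `a`, `b` one always exceeds `1`, then the means of `a` under `p` and of
`b` under `q` cannot both be small. -/
theorem exp_neg_half_le_of_hasSum {α : Type*} {p q a b L : α → ℝ} {m A B t : ℝ}
    (hp : HasSum p 1) (hq : HasSum q 1) (hp0 : ∀ x, 0 ≤ p x) (hq0 : ∀ x, 0 ≤ q x)
    (ha0 : ∀ x, 0 ≤ a x) (hb0 : ∀ x, 0 ≤ b x) (hab : ∀ x, 1 ≤ a x ∨ 1 ≤ b x)
    (hL : HasSum (fun x => p x * L x) m) (hA : HasSum (fun x => p x * a x) A)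
    (hB : HasSum (fun x => q x * b x) B) (hpq : ∀ x, p x * Real.exp (-L x) ≤ q x) (ht : 0 < t) :
    Real.exp (-m / 2) ≤ (t * A + 2 / t + t * B) / 2 := by
  -- Jensen's inequality for `exp (-L / 2)`, in the form of the tangent line at the mean `m`, so
  -- that only sums known to converge appear.
  have h1 : HasSum (fun x => Real.exp (-m / 2) * ((1 + m / 2) * p x - p x * L x / 2))
      (Real.exp (-m / 2) * ((1 + m / 2) * 1 - m / 2)) :=
    ((hp.mul_left _).sub (hL.div_const 2)).mul_left _
  have h2 : HasSum (fun x => (t * (p x * a x) + (p x + q x) / t + t * (q x * b x)) / 2)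
      ((t * A + (1 + 1) / t + t * B) / 2) :=
    ((((hA.mul_left t).add ((hp.add hq).div_const t)).add (hB.mul_left t))).div_const 2
  have h3 := hasSum_le (fun x => ?_) h1 h2
  · calc Real.exp (-m / 2) = Real.exp (-m / 2) * ((1 + m / 2) * 1 - m / 2) := by ring
      _ ≤ _ := h3
      _ = _ := by norm_num
  · have hm : Real.exp (-m / 2) * ((1 + m / 2) * p x - p x * L x / 2)
        ≤ p x * Real.exp (-L x / 2) := by
      have := Real.add_one_le_exp (m / 2 - L x / 2)
      calc _ = p x * (Real.exp (-m / 2) * (m / 2 - L x / 2 + 1)) := by ring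
        _ ≤ p x * (Real.exp (-m / 2) * Real.exp (m / 2 - L x / 2)) := by
            have := hp0 x
            gcongr
        _ = _ := by rw [← Real.exp_add]; ring_nf
    refine hm.trans ?_
    set y := Real.exp (-L x / 2) with hy
    have hy2 : p x * y ^ 2 ≤ q x := by
      rw [hy, sq, ← Real.exp_add]
      convert hpq x using 3; ring
    -- AM-GM with weight `t`: `e1` serves where `a ≥ 1` and `e2` where `b ≥ 1`. The small weight `1
    -- / t` falls on the mass that the statistic does not control.
    have e1 : p x * y ≤ (t * p x + q x / t) / 2 := by
      have : 0 ≤ p x * (t - y) ^ 2 := mul_nonneg (hp0 x) (sq_nonneg _)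
      have h5 : t * (2 * (p x * y)) ≤ t * (t * p x + q x / t) := by
        have : t * (t * p x + q x / t) = t ^ 2 * p x + q x := by field_simp
        rw [this]; nlinarith
      have := le_of_mul_le_mul_left h5 ht
      linarith
    have e2 : p x * y ≤ (p x / t + t * q x) / 2 := by
      have : 0 ≤ p x * (1 - t * y) ^ 2 := mul_nonneg (hp0 x) (sq_nonneg _)
      have h5 : t * (2 * (p x * y)) ≤ t * (p x / t + t * q x) := by
        have h6 : t * (p x / t + t * q x) = p x + t ^ 2 * q x := by field_simp
        rw [h6]; nlinarith [mul_le_mul_of_nonneg_left hy2 (sq_nonneg t)]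
      have := le_of_mul_le_mul_left h5 ht
      linarith
    have hpt : 0 ≤ p x / t := div_nonneg (hp0 x) ht.le
    have hqt : 0 ≤ q x / t := div_nonneg (hq0 x) ht.le
    have hta : 0 ≤ t * (p x * a x) := mul_nonneg ht.le (mul_nonneg (hp0 x) (ha0 x))
    have htb : 0 ≤ t * (q x * b x) := mul_nonneg ht.le (mul_nonneg (hq0 x) (hb0 x))
    rw [add_div (p x)]
    rcases hab x with h | h
    · have : t * p x ≤ t * (p x * a x) := by
        have := mul_le_mul_of_nonneg_left h (mul_nonneg ht.le (hp0 x)); linarith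
      linarith
    · have : t * q x ≤ t * (q x * b x) := by
        have := mul_le_mul_of_nonneg_left h (mul_nonneg ht.le (hq0 x)); linarith
      linarith

section Conv

variable {M : Type*} [AddMonoid M] [MeasurableSpace M] [MeasurableAdd₂ M]

theorem MeasureTheory.Measure.conv_le_conv {μ μ' ν ν' : Measure M} [SFinite ν] [SFinite ν']
    (hμ : μ ≤ μ') (hν : ν ≤ ν') : Measure.conv μ ν ≤ Measure.conv μ' ν' := by
  refine Measure.le_intro fun s hs _ => ?_
  rw [← lintegral_indicator_one hs, ← lintegral_indicator_one hs,
    Measure.lintegral_conv (measurable_one.indicator hs),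
    Measure.lintegral_conv (measurable_one.indicator hs)]
  exact lintegral_mono' hμ fun x => lintegral_mono' hν le_rfl

end Conv

/-! ### Kullback-Leibler divergence on the natural numbers -/

section DiscreteKL

variable {μ ν ν' : Measure ℕ}

theorem rnDeriv_mul_singleton [SigmaFinite μ] [SigmaFinite ν] (h : μ ≪ ν) (k : ℕ) :
    μ.rnDeriv ν k * ν {k} = μ {k} := by
  conv_rhs => rw [← Measure.withDensity_rnDeriv_eq μ ν h]
  rw [withDensity_apply _ (measurableSet_singleton k), lintegral_singleton]

theorem llr_eq_log_sub_log [IsFiniteMeasure μ] [IsFiniteMeasure ν] (h : μ ≪ ν) {k : ℕ}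
    (hk : μ {k} ≠ 0) : llr μ ν k = Real.log (μ.real {k}) - Real.log (ν.real {k}) := by
  have h1 := rnDeriv_mul_singleton h k
  have hr : μ.real {k} = (μ.rnDeriv ν k).toReal * ν.real {k} := by
    rw [measureReal_def, measureReal_def, ← ENNReal.toReal_mul, h1]
  have h0 : μ.real {k} ≠ 0 := (measureReal_ne_zero_iff).2 hk
  rw [llr_def, hr, Real.log_mul]
  · ring
  · rintro h2; rw [hr, h2, zero_mul] at h0; exact h0 rfl
  · rintro h2; rw [hr, h2, mul_zero] at h0; exact h0 rfl

/-- Equality holds at the atoms of `μ`; elsewhere the left side is `0`, whatever the value of `llr`.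
-/
theorem mul_exp_neg_llr_le [IsFiniteMeasure μ] [IsFiniteMeasure ν] (h : μ ≪ ν) (k : ℕ) :
    μ {k} * ENNReal.ofReal (Real.exp (-llr μ ν k)) ≤ ν {k} := by
  by_cases hk : μ {k} = 0
  · simp [hk]
  have hν : ν {k} ≠ 0 := fun h0 => hk (h h0)
  have hμ' : 0 < μ.real {k} := measureReal_nonneg.lt_of_ne' ((measureReal_ne_zero_iff).2 hk)
  have hν' : 0 < ν.real {k} := measureReal_nonneg.lt_of_ne' ((measureReal_ne_zero_iff).2 hν)
  rw [llr_eq_log_sub_log h hk, neg_sub, Real.exp_sub, Real.exp_log hμ', Real.exp_log hν',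
    ← ofReal_measureReal (μ := μ), ← ofReal_measureReal (μ := ν), ← ENNReal.ofReal_mul hμ'.le,
    mul_div_cancel₀ _ hμ'.ne']

theorem absolutelyContinuous_of_singleton (h : ∀ k, μ {k} ≠ 0 → ν {k} ≠ 0) : μ ≪ ν := by
  intro s hs
  rw [measure_null_iff_singleton s.to_countable]
  intro k hk
  by_contra h0
  exact h k h0 (measure_mono_null (Set.singleton_subset_iff.2 hk) hs)

/-- At atoms of `μ`, the density is at most `1 / (c * q ^ k)`, so its logarithm grows at most
linearly in `k`, and `μ` has finite mean. -/
theorem klDiv_ne_top_of_geometric_le [IsProbabilityMeasure μ] [IsProbabilityMeasure ν]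
    {c q : ℝ} (hc : 0 < c) (hq : 0 < q) (hq1 : q ≤ 1) (hmean : ∫⁻ k, (k : ℝ≥0∞) ∂μ ≠ ∞)
    (h : ∀ k, μ {k} ≠ 0 → ENNReal.ofReal (c * q ^ k) ≤ ν {k}) : klDiv μ ν ≠ ∞ := by
  have hpos : ∀ k : ℕ, 0 < c * q ^ k := fun k => by positivity
  have hac : μ ≪ ν := absolutelyContinuous_of_singleton fun k hk =>
    ((ENNReal.ofReal_pos.2 (hpos k)).trans_le (h k hk)).ne'
  have hlogq : 0 ≤ -Real.log q := by have := Real.log_nonpos hq.le hq1; linarith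
  rw [klDiv_eq_lintegral_klFun_of_ac hac]
  refine ne_top_of_le_ne_top (b := ∫⁻ k, (μ.rnDeriv ν k * (ENNReal.ofReal |Real.log c| +
    k * ENNReal.ofReal (-Real.log q)) + 1) ∂ν) ?_ ?_
  · rw [lintegral_add_right _ measurable_const, lintegral_rnDeriv_mul hac (by fun_prop),
      lintegral_add_left measurable_const, lintegral_mul_const _ (by fun_prop)]
    simp only [lintegral_const, measure_univ, mul_one]
    exact ENNReal.add_ne_top.2 ⟨ENNReal.add_ne_top.2 ⟨ENNReal.ofReal_ne_top,
      ENNReal.mul_ne_top hmean ENNReal.ofReal_ne_top⟩, ENNReal.one_ne_top⟩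
  · refine lintegral_mono_ae ((ae_iff_of_countable).2 fun k hk => ?_)
    set r := (μ.rnDeriv ν k).toReal with hr
    have htop : μ.rnDeriv ν k ≠ ∞ := by
      intro h1
      have := rnDeriv_mul_singleton hac k
      rw [h1, ENNReal.top_mul hk] at this
      exact measure_ne_top μ _ this.symm
    have hkl : klFun r ≤ r * (|Real.log c| + k * (-Real.log q)) + 1 := by
      rw [klFun_apply]
      have hr0 : 0 ≤ r := ENNReal.toReal_nonneg
      rcases hr0.eq_or_lt with h0 | h0
      · simp [← h0]
      · have hμk : μ {k} ≠ 0 := by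
          rw [← rnDeriv_mul_singleton hac k]
          exact mul_ne_zero (fun h2 => by simp [hr, h2] at h0) hk
        have h1 : r * ν.real {k} = μ.real {k} := by
          rw [hr, measureReal_def, measureReal_def, ← ENNReal.toReal_mul,
            rnDeriv_mul_singleton hac k]
        have h2 : c * q ^ k ≤ ν.real {k} :=
          (ENNReal.ofReal_le_iff_le_toReal (measure_ne_top _ _)).1 (h k hμk)
        have h3 : r * (c * q ^ k) ≤ 1 :=
          (mul_le_mul_of_nonneg_left h2 hr0).trans (h1.trans_le measureReal_le_one)
        have h4 : Real.log r + (Real.log c + k * Real.log q) ≤ 0 := by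
          rw [← Real.log_pow, ← Real.log_mul hc.ne' (by positivity),
            ← Real.log_mul h0.ne' (hpos k).ne']
          exact Real.log_nonpos (by positivity) h3
        have h5 := neg_abs_le (Real.log c)
        nlinarith
    have hnn : 0 ≤ |Real.log c| + k * (-Real.log q) := by positivity
    refine (ENNReal.ofReal_le_ofReal hkl).trans_eq ?_
    rw [ENNReal.ofReal_add (mul_nonneg ENNReal.toReal_nonneg hnn) zero_le_one,
      ENNReal.ofReal_mul ENNReal.toReal_nonneg, ENNReal.ofReal_toReal htop, ENNReal.ofReal_one,
      ENNReal.ofReal_add (abs_nonneg _) (by positivity), ENNReal.ofReal_mul (by positivity),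
      ENNReal.ofReal_natCast]

theorem toReal_klDiv_eq_integral_llr [IsProbabilityMeasure μ] [IsProbabilityMeasure ν]
    (h : μ ≪ ν) : (klDiv μ ν).toReal = ∫ k, llr μ ν k ∂μ :=
  toReal_klDiv_of_measure_eq h (by simp)

/-- Replacing `ν` by `ν'` raises the log-likelihood ratio by at most `-log c` pointwise. The
assumption `hfin` makes the ratio against `ν'` integrable. -/
theorem klDiv_le_add_of_mul_le [IsProbabilityMeasure μ] [IsProbabilityMeasure ν]
    [IsProbabilityMeasure ν'] {c : ℝ} (hc : 0 < c) (hν : ∀ k, ENNReal.ofReal c * ν {k} ≤ ν' {k})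
    (hfin : klDiv μ ν' ≠ ∞) : klDiv μ ν' ≤ klDiv μ ν + ENNReal.ofReal (-Real.log c) := by
  by_cases htop : klDiv μ ν = ∞
  · simp [htop]
  obtain ⟨hac, hint⟩ := klDiv_ne_top_iff.1 htop
  obtain ⟨hac', hint'⟩ := klDiv_ne_top_iff.1 hfin
  have hle : (klDiv μ ν').toReal ≤ (klDiv μ ν).toReal + -Real.log c := by
    rw [toReal_klDiv_eq_integral_llr hac, toReal_klDiv_eq_integral_llr hac']
    have : ∫ k, (llr μ ν k + -Real.log c) ∂μ = ∫ k, llr μ ν k ∂μ + -Real.log c := by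
      rw [integral_add hint (integrable_const _)]; simp
    rw [← this]
    refine integral_mono_ae hint' (hint.add (integrable_const _))
      ((ae_iff_of_countable).2 fun k hk => ?_)
    have h1 : 0 < ν.real {k} :=
      measureReal_nonneg.lt_of_ne' ((measureReal_ne_zero_iff).2 fun h0 => hk (hac h0))
    have h2 : c * ν.real {k} ≤ ν'.real {k} := by
      have := ENNReal.toReal_mono (measure_ne_top _ _) (hν k)
      rwa [ENNReal.toReal_mul, ENNReal.toReal_ofReal hc.le] at this
    have h3 := Real.log_le_log (mul_pos hc h1) h2
    rw [Real.log_mul hc.ne' h1.ne'] at h3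
    simp only [llr_eq_log_sub_log hac hk, llr_eq_log_sub_log hac' hk]
    linarith
  rw [← ENNReal.ofReal_toReal hfin]
  refine (ENNReal.ofReal_le_ofReal hle).trans (ENNReal.ofReal_add_le.trans ?_)
  rw [ENNReal.ofReal_toReal htop]

end DiscreteKL

/-! ### The delay of one link -/

section LinkDelay

theorem linkDelay_succ (t : Set.Ioc (0 : ℝ) 1) (k : ℕ) :
    linkDelay t {k + 1} = ENNReal.ofReal ((1 - t) ^ k * t) := by
  have h0 : (⟨t.1, t.2.1.le, t.2.2⟩ : unitInterval) ≠ 0 := fun h =>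
    t.2.1.ne' (congrArg Subtype.val h)
  rw [linkDelay, Measure.map_apply (by fun_prop) (measurableSet_singleton _)]
  rw [show (fun k => k + 1) ⁻¹' {k + 1} = ({k} : Set ℕ) by ext; simp,
    geometricMeasure_singleton h0]

theorem linkDelay_zero (t : Set.Ioc (0 : ℝ) 1) : linkDelay t {0} = 0 := by
  rw [linkDelay, Measure.map_apply (by fun_prop) (measurableSet_singleton _)]
  rw [show (fun k => k + 1) ⁻¹' {0} = (∅ : Set ℕ) by ext; simp, measure_empty]

theorem lintegral_linkDelay (t : Set.Ioc (0 : ℝ) 1) :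
    ∫⁻ k, (k : ℝ≥0∞) ∂linkDelay t = ENNReal.ofReal (1 / t) := by
  have ht := t.2.1
  have ht1 := t.2.2
  have hn : ‖1 - (t : ℝ)‖ < 1 := by rw [Real.norm_eq_abs, abs_lt]; constructor <;> linarith
  have hs := (hasSum_choose_mul_geometric_of_norm_lt_one 1 hn).mul_right (t : ℝ)
  rw [lintegral_countable', tsum_eq_zero_add' ENNReal.summable, linkDelay_zero, mul_zero, zero_add]
  have hval : (1 : ℝ) / (1 - (1 - t)) ^ (1 + 1) * t = 1 / t := by field_simp; ring
  rw [hval] at hs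
  rw [← hs.tsum_eq, ENNReal.ofReal_tsum_of_nonneg _ hs.summable]
  · refine tsum_congr fun k => ?_
    rw [linkDelay_succ, ← ENNReal.ofReal_natCast, ← ENNReal.ofReal_mul (by positivity)]
    simp only [Nat.choose_one_right]
    push_cast
    ring_nf
  · intro k
    have : 0 ≤ 1 - (t : ℝ) := by linarith
    positivity

theorem smul_dirac_le_linkDelay (t : Set.Ioc (0 : ℝ) 1) :
    ENNReal.ofReal t • Measure.dirac 1 ≤ linkDelay t := by
  refine Measure.le_iff.2 fun s _ => ?_
  by_cases h : 1 ∈ s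
  · simp only [Measure.smul_apply, Measure.dirac_apply_of_mem h, smul_eq_mul, mul_one]
    calc ENNReal.ofReal t = linkDelay t {0 + 1} := by rw [linkDelay_succ]; simp
      _ ≤ _ := measure_mono (by simpa using h)
  · simp [h]

theorem linkDelay_one {t : Set.Ioc (0 : ℝ) 1} (ht : (t : ℝ) = 1) :
    linkDelay t = Measure.dirac 1 := by
  refine Measure.ext_of_singleton fun k => ?_
  cases k with
  | zero => simp [linkDelay_zero]
  | succ k => rw [linkDelay_succ, ht]; cases k <;> simp

end LinkDelay

/-! ### The total delay of a set of links -/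

section LinksDelay

variable {E : Type*} [Fintype E]

/-- The law of the total delay of a set of links. -/
def linksDelay (θ : Params E) (s : Finset E) : Measure ℕ :=
  (Measure.pi fun i => linkDelay (θ i)).map (fun d => ∑ i ∈ s, d i)

instance (θ : Params E) (s : Finset E) : IsProbabilityMeasure (linksDelay θ s) :=
  Measure.isProbabilityMeasure_map (Measurable.of_discrete).aemeasurable

theorem linksDelay_empty (θ : Params E) : linksDelay θ ∅ = Measure.dirac 0 := by
  simp [linksDelay, Measure.map_const]

theorem linksDelay_insert [DecidableEq E] (θ : Params E) {s : Finset E} {a : E} (ha : a ∉ s) :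
    linksDelay θ (insert a s) = Measure.conv (linksDelay θ s) (linkDelay (θ a)) := by
  have hind : iIndepFun (fun i (d : E → ℕ) => d i) (Measure.pi fun i => linkDelay (θ i)) :=
    iIndepFun_pi (X := fun _ => id) fun i => aemeasurable_id
  have h2 := hind.indepFun_finsetSum_of_notMem (fun i => measurable_pi_apply i) ha
  have h3 := h2.map_add_eq_map_conv_map Measurable.of_discrete (measurable_pi_apply a)
  rw [(measurePreserving_eval _ a).map_eq] at h3
  rw [linksDelay, linksDelay]
  convert h3 using 2
  · ext d; simp [Finset.sum_insert ha, add_comm]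
  · congr 1; ext d; simp

/-- The law is a convolution of link laws; links with equal parameters are matched and removed one
pair at a time. -/
theorem linksDelay_eq_of_map_eq {θ lam : Params E} {s s' : Finset E}
    (h : s.val.map θ = s'.val.map lam) : linksDelay θ s = linksDelay lam s' := by
  classical
  induction s using Finset.induction_on generalizing s' with
  | empty =>
    have : s' = ∅ := by simpa using h.symm
    rw [this, linksDelay_empty, linksDelay_empty]
  | insert a s ha ih =>
    rw [Finset.insert_val_of_notMem ha, Multiset.map_cons] at h
    obtain ⟨b, hb, hba⟩ := Multiset.mem_map.1 (h ▸ Multiset.mem_cons_self (θ a) (s.val.map θ))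
    have hb' : b ∈ s' := hb
    have hbn := Finset.notMem_erase b s'
    rw [← Finset.insert_erase hb', Finset.insert_val_of_notMem hbn, Multiset.map_cons, hba,
      Multiset.cons_inj_right] at h
    rw [linksDelay_insert θ ha, ih h, ← hba, ← linksDelay_insert lam hbn, Finset.insert_erase hb']

theorem smul_linksDelay_le {lam lam' : Params E} {c : ℝ≥0∞} (s : Finset E)
    (h : ∀ i ∈ s, c • linkDelay (lam i) ≤ linkDelay (lam' i)) :
    c ^ s.card • linksDelay lam s ≤ linksDelay lam' s := by
  classical
  induction s using Finset.induction_on with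
  | empty => simp [linksDelay_empty]
  | insert a s ha ih =>
    rw [Finset.card_insert_of_notMem ha, linksDelay_insert _ ha, linksDelay_insert _ ha, pow_succ,
      mul_smul, ← Measure.conv_smul_right, ← Measure.conv_smul_left]
    exact Measure.conv_le_conv (ih fun i hi => h i (Finset.mem_insert_of_mem hi))
      (h a (Finset.mem_insert_self a s))

theorem smul_dirac_le_linksDelay (θ : Params E) (s : Finset E) :
    (∏ i ∈ s, ENNReal.ofReal (θ i)) • Measure.dirac s.card ≤ linksDelay θ s := by
  classical
  induction s using Finset.induction_on with
  | empty => simp [linksDelay_empty]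
  | insert a s ha ih =>
    rw [Finset.card_insert_of_notMem ha, linksDelay_insert _ ha, Finset.prod_insert ha, mul_comm,
      ← Measure.dirac_conv_dirac, mul_smul, ← Measure.conv_smul_right, ← Measure.conv_smul_left]
    exact Measure.conv_le_conv ih (smul_dirac_le_linkDelay _)

theorem linksDelay_singleton_eq_zero (θ : Params E) {s : Finset E} {k : ℕ} (hk : k < s.card) :
    linksDelay θ s {k} = 0 := by
  have h1 : ∀ i, ∀ᵐ d ∂(Measure.pi fun i => linkDelay (θ i)), 1 ≤ d i := fun i => by
    refine (measurePreserving_eval (fun i => linkDelay (θ i)) i).quasiMeasurePreserving.ae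
      (p := fun n : ℕ => 1 ≤ n) ((ae_iff_of_countable).2 fun k hk => ?_)
    rcases Nat.eq_zero_or_pos k with rfl | h
    · exact absurd (linkDelay_zero _) hk
    · exact h
  rw [linksDelay, Measure.map_apply Measurable.of_discrete (measurableSet_singleton k)]
  refine measure_mono_null ?_ (ae_iff.1 (ae_all_iff.2 h1))
  intro d hd h2
  have h3 : ∑ i ∈ s, d i = k := hd
  have := Finset.card_nsmul_le_sum s d 1 fun i _ => h2 i
  rw [h3] at this
  simp at this
  omega

/-- One way to reach total delay `k` is that every link except `a` takes one slot and `a` takes all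
the rest. -/
theorem exists_geometric_le_linksDelay (θ : Params E) {s : Finset E} {a : E} (ha : a ∈ s)
    (h1 : (θ a : ℝ) < 1) : ∃ c : ℝ, 0 < c ∧ ∀ k, s.card ≤ k →
      ENNReal.ofReal (c * (1 - θ a) ^ k) ≤ linksDelay θ s {k} := by
  classical
  set s₀ := s.erase a with hs₀
  have han : a ∉ s₀ := Finset.notMem_erase a s
  have hs : s = insert a s₀ := (Finset.insert_erase ha).symm
  have h0 := (θ a).2.1
  have hprod : 0 < ∏ i ∈ s₀, (θ i : ℝ) := Finset.prod_pos fun i _ => (θ i).2.1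
  refine ⟨(∏ i ∈ s₀, (θ i : ℝ)) * θ a, by positivity, fun k hk => ?_⟩
  rw [hs, Finset.card_insert_of_notMem han] at hk
  obtain ⟨j, rfl⟩ := Nat.exists_eq_add_of_le hk
  have hle := Measure.conv_le_conv (smul_dirac_le_linksDelay θ s₀) (le_refl (linkDelay (θ a)))
  rw [← linksDelay_insert θ han, ← hs] at hle
  refine le_trans ?_ (hle {s₀.card + 1 + j})
  rw [Measure.conv_smul_left, Measure.dirac_conv, Measure.smul_apply,
    Measure.map_apply (by fun_prop) (measurableSet_singleton _),
    show (fun y => s₀.card + y) ⁻¹' {s₀.card + 1 + j} = ({j + 1} : Set ℕ) by ext; simp; omega,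
    linkDelay_succ, smul_eq_mul, ← ENNReal.ofReal_prod_of_nonneg fun i _ => (θ i).2.1.le,
    ← ENNReal.ofReal_mul hprod.le, mul_assoc]
  have hq0 : 0 ≤ 1 - (θ a : ℝ) := by linarith
  -- The true exponent is `j = k - s.card`; raising it to `k` only weakens the bound.
  refine ENNReal.ofReal_le_ofReal (mul_le_mul_of_nonneg_left ?_ hprod.le)
  rw [mul_comm]
  exact mul_le_mul_of_nonneg_right
    (pow_le_pow_of_le_one hq0 (by linarith) (Nat.le_add_left j _)) h0.le

theorem lintegral_linksDelay (θ : Params E) (s : Finset E) :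
    ∫⁻ k, (k : ℝ≥0∞) ∂linksDelay θ s = ENNReal.ofReal (∑ i ∈ s, 1 / (θ i : ℝ)) := by
  rw [linksDelay, lintegral_map (by fun_prop) Measurable.of_discrete]
  push_cast
  rw [lintegral_finsetSum _ (fun i _ => by fun_prop),
    ENNReal.ofReal_sum_of_nonneg fun i _ => by have := (θ i).2.1; positivity]
  refine Finset.sum_congr rfl fun i _ => ?_
  rw [← lintegral_linkDelay]
  exact (measurePreserving_eval (fun i => linkDelay (θ i)) i).lintegral_comp
    (f := fun n : ℕ => (n : ℝ≥0∞)) (by fun_prop)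

theorem klDiv_linksDelay_ne_top (θ lam : Params E) {s : Finset E} {a : E} (ha : a ∈ s)
    (h1 : (lam a : ℝ) < 1) : klDiv (linksDelay θ s) (linksDelay lam s) ≠ ∞ := by
  obtain ⟨c, hc, hle⟩ := exists_geometric_le_linksDelay lam ha h1
  refine klDiv_ne_top_of_geometric_le hc (q := 1 - lam a) (by linarith)
    (by have := (lam a).2.1; linarith) (by rw [lintegral_linksDelay]; exact ENNReal.ofReal_ne_top)
    fun k hk => hle k ?_
  by_contra! h
  exact hk (linksDelay_singleton_eq_zero θ h)

end LinksDelay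

namespace Network

variable {V E : Type*} [Fintype E] {G : Network V E}

/-! ### The logarithmic lower bound on information -/

section InformationBound

variable (π : G.BanditPolicy) (θ : Params E)

theorem hasSum_toReal_expect {n : ℕ} {f : G.History n → ℝ≥0∞} (hf : expect π θ n f ≠ ∞) :
    HasSum (fun h => (historyLaw π θ n h).toReal * (f h).toReal) (expect π θ n f).toReal := by
  have := (ENNReal.summable_toReal hf).hasSum
  rw [← ENNReal.tsum_toReal_eq fun h => ENNReal.ne_top_of_tsum_ne_top hf h] at this
  simpa only [ENNReal.toReal_mul, expect] using this

theorem hasSum_historyLaw (n : ℕ) : HasSum (fun h => (historyLaw π θ n h).toReal) 1 := by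
  simpa [expect_const] using hasSum_toReal_expect π θ (n := n) (f := fun _ => 1)
    (by simp [expect_const])

/-- Wald's identity for integrable additive functionals of either sign. -/
theorem hasSum_sum_history {g : G.Path → ℕ → ℝ} (hg : ∀ p, Integrable (g p) (pathDelay θ p))
    (n : ℕ) :
    HasSum (fun h : G.History n => (historyLaw π θ n h).toReal * ∑ j, g (h j).1 (h j).2)
      (∑ p, (plays π θ p n).toReal * ∫ k, g p k ∂pathDelay θ p) := by
  -- The nonnegative identity is applied to the positive parts of `g` and `-g`, both of finite mean,
  -- and the results are subtracted.
  have hpart : ∀ g : G.Path → ℕ → ℝ, (∀ p, Integrable (g p) (pathDelay θ p)) →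
      HasSum (fun h : G.History n => (historyLaw π θ n h).toReal * ∑ j, max (g (h j).1 (h j).2) 0)
        (∑ p, (plays π θ p n).toReal *
          (∫⁻ k, ENNReal.ofReal (g p k) ∂pathDelay θ p).toReal) := by
    intro g hg
    have hw := expect_sum_history π θ (fun p k => ENNReal.ofReal (g p k)) n
    have hfin : ∀ p ∈ Finset.univ,
        plays π θ p n * ∫⁻ k, ENNReal.ofReal (g p k) ∂pathDelay θ p ≠ ∞ := fun p _ =>
      ENNReal.mul_ne_top (plays_ne_top π θ p n) (hg p).lintegral_lt_top.ne
    have := hasSum_toReal_expect π θ (n := n)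
      (f := fun h => ∑ j, ENNReal.ofReal (g (h j).1 (h j).2))
      (by rw [hw]; exact ENNReal.sum_ne_top.2 hfin)
    rw [hw, ENNReal.toReal_sum hfin] at this
    simpa only [ENNReal.toReal_mul, ENNReal.toReal_sum fun _ _ => ENNReal.ofReal_ne_top,
      ENNReal.toReal_ofReal'] using this
  have hsub := (hpart g hg).sub (hpart (fun p k => -g p k) fun p => (hg p).neg)
  rw [← Finset.sum_sub_distrib] at hsub
  simp_rw [← mul_sub, ← fun p => integral_eq_lintegral_pos_part_sub_lintegral_neg_part (hg p),
    ← Finset.sum_sub_distrib] at hsub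
  refine (congrArg (fun f => HasSum f _) (funext fun h => ?_)).mp hsub
  congr 1
  refine Finset.sum_congr rfl fun j _ => ?_
  rcases le_total (g (h j).1 (h j).2) 0 with h0 | h0
  · rw [max_eq_right h0, max_eq_left (by linarith)]; ring
  · rw [max_eq_left h0, max_eq_right (by linarith)]; ring

-- Each packet is counted at least once: on `p⋆` it is sub-optimal under `lam`, elsewhere under `θ`.
omit [Fintype E] in
theorem ncard_isSuboptimal_add (lam : Params E) {pstar : G.Path}
    (hstar : ∀ p, p ≠ pstar → IsSuboptimal θ p) (hlam : IsSuboptimal lam pstar) {n : ℕ}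
    (h : G.History n) : n ≤ ({j | IsSuboptimal θ (h j).1} : Set (Fin n)).ncard +
      ({j | IsSuboptimal lam (h j).1} : Set (Fin n)).ncard := by
  have hu : ({j | IsSuboptimal θ (h j).1} ∪ {j | IsSuboptimal lam (h j).1} : Set (Fin n)) =
      Set.univ := by
    refine Set.eq_univ_of_forall fun j => ?_
    by_cases hj : (h j).1 = pstar
    · exact Or.inr (by rw [Set.mem_ofPred_eq, hj]; exact hlam)
    · exact Or.inl (hstar _ hj)
  have := Set.ncard_union_le {j | IsSuboptimal θ (h j).1} {j | IsSuboptimal lam (h j).1}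
  rwa [hu, Set.ncard_univ, Nat.card_eq_fintype_card, Fintype.card_fin] at this

/-- If `p⋆` is the only optimal path under `θ` and is not optimal under `lam`, then the
information accumulated by a uniformly good policy grows at least logarithmically. -/
theorem UniformlyGood.eventually_le_sum_plays_mul_klDiv {π : G.BanditPolicy}
    (hπ : UniformlyGood π) {θ lam : Params E} {pstar : G.Path}
    (hstar : ∀ p, p ≠ pstar → IsSuboptimal θ p) (hlam : IsSuboptimal lam pstar)
    (hkl : ∀ p : G.Path, klDiv (pathDelay θ p) (pathDelay lam p) ≠ ∞) {α : ℝ} (hα : 0 < α) :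
    ∀ᶠ N : ℕ in atTop, (1 - α) * Real.log N - 2 * Real.log 2 ≤
      ∑ p, (plays π θ p N).toReal * (klDiv (pathDelay θ p) (pathDelay lam p)).toReal := by
  have hu := ((hπ θ α hα).add (hπ lam α hα)).bound one_pos
  filter_upwards [hu, eventually_ge_atTop 1] with N hN hN1
  have hNpos : (0 : ℝ) < N := by exact_mod_cast hN1
  set A := (expectedSuboptimal π θ N).toReal with hA
  set B := (expectedSuboptimal π lam N).toReal with hB
  have hAB : A + B ≤ (N : ℝ) ^ α := by
    rw [one_mul, Real.norm_of_nonneg (by positivity), Real.norm_of_nonneg (by positivity)] at hN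
    exact hN
  have hac : ∀ p : G.Path, pathDelay θ p ≪ pathDelay lam p := fun p =>
    (klDiv_ne_top_iff.1 (hkl p)).1
  -- This `t` balances the error terms: `t / N * N ^ α = 1 / t`. The resulting bound `exp (-m / 2) ≤
  -- 2 / t` gives the sharp coefficient `1 - α` of `log N`.
  set t := (N : ℝ) ^ ((1 - α) / 2) with ht
  have htpos : 0 < t := Real.rpow_pos_of_pos hNpos _
  have htt : t * t * (N : ℝ) ^ α = N := by
    rw [ht, ← Real.rpow_add hNpos, ← Real.rpow_add hNpos]
    ring_nf
    exact Real.rpow_one _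
  have hm := hasSum_sum_history π θ
    (g := fun p => llr (pathDelay θ p) (pathDelay lam p))
    (fun p => (klDiv_ne_top_iff.1 (hkl p)).2) N
  simp_rw [← fun p => toReal_klDiv_eq_integral_llr (hac p)] at hm
  -- The factor `2 / N` makes one of the two statistics at least `1`, as one of the two counts is at
  -- least `N / 2`.
  have hsub : ∀ lam : Params E, HasSum (fun h : G.History N => (historyLaw π lam N h).toReal *
      (2 / N * (({j | IsSuboptimal lam (h j).1} : Set (Fin N)).ncard : ℝ)))
      (2 / N * (expectedSuboptimal π lam N).toReal) := fun lam => by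
    have := (hasSum_toReal_expect π lam (expectedSuboptimal_ne_top π lam N)).mul_left (2 / (N : ℝ))
    simpa only [ENNReal.toReal_natCast, mul_left_comm, expectedSuboptimal] using this
  have key := exp_neg_half_le_of_hasSum (t := t) (hasSum_historyLaw π θ N)
    (hasSum_historyLaw π lam N) (fun _ => ENNReal.toReal_nonneg) (fun _ => ENNReal.toReal_nonneg)
    (fun _ => by positivity) (fun _ => by positivity) (fun h => ?_) hm (hsub θ) (hsub lam)
    (fun h => ?_) htpos
  · have h1 : (t * (2 / N * A) + 2 / t + t * (2 / N * B)) / 2 ≤ 2 / t := by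
      have h2 : (t * (2 / N * A) + 2 / t + t * (2 / N * B)) / 2 = t / N * (A + B) + 1 / t := by
        ring
      have h3 : t / N * (A + B) ≤ 1 / t := by
        calc t / N * (A + B) ≤ t / N * (N : ℝ) ^ α := by gcongr
          _ = 1 / t := by rw [div_mul_eq_mul_div, div_eq_div_iff hNpos.ne' htpos.ne']; linarith
      rw [h2]
      linarith [show 2 / t = 1 / t + 1 / t by ring]
    have h4 := Real.log_le_log (Real.exp_pos _) (key.trans h1)
    rw [Real.log_exp, Real.log_div two_ne_zero htpos.ne', ht, Real.log_rpow hNpos] at h4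
    linarith
  · have h1 : (N : ℝ) ≤ ({j | IsSuboptimal θ (h j).1} : Set (Fin N)).ncard +
        ({j | IsSuboptimal lam (h j).1} : Set (Fin N)).ncard := by
      exact_mod_cast ncard_isSuboptimal_add θ lam hstar hlam h
    rw [div_mul_eq_mul_div, div_mul_eq_mul_div, le_div_iff₀ hNpos, le_div_iff₀ hNpos]
    by_contra! hcon
    linarith [hcon.1, hcon.2]
  · have := ENNReal.toReal_mono (PMF.apply_ne_top _ _) (historyLaw_mul_exp_le π θ lam
      (fun p => llr (pathDelay θ p) (pathDelay lam p))
      (fun p k => mul_exp_neg_llr_le (hac p) k) N h)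
    rwa [ENNReal.toReal_mul, ENNReal.toReal_ofReal (Real.exp_nonneg _)] at this

end InformationBound

/-! ### Regret in terms of the expected path counts -/

section Regret

theorem lintegral_pathDelay (θ : Params E) (p : G.Path) :
    ∫⁻ k, (k : ℝ≥0∞) ∂pathDelay θ p = ENNReal.ofReal (avgDelay θ p) :=
  lintegral_linksDelay θ p.links

omit [Fintype E] in
theorem avgDelay_nonneg (θ : Params E) (p : G.Path) : 0 ≤ avgDelay θ p :=
  Finset.sum_nonneg fun i _ => by have := (θ i).2.1; positivity

theorem sum_toReal_plays (π : G.BanditPolicy) (θ : Params E) (n : ℕ) :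
    ∑ p, (plays π θ p n).toReal = n := by
  rw [← ENNReal.toReal_sum fun p _ => plays_ne_top π θ p n, sum_plays, ENNReal.toReal_natCast]

theorem regret_eq (π : G.BanditPolicy) (θ : Params E) (pstar : G.Path) (N : ℕ) :
    regret π θ pstar N =
      ((∑ p, (plays π θ p N).toReal * (avgDelay θ p - avgDelay θ pstar) : ℝ) : EReal) := by
  have h1 : expect π θ N (fun h => ∑ j, ((h j).2 : ℝ≥0∞)) =
      ENNReal.ofReal (∑ p, (plays π θ p N).toReal * avgDelay θ p) := by
    rw [expect_sum_history π θ (fun _ k => (k : ℝ≥0∞)) N, ENNReal.ofReal_sum_of_nonneg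
      fun p _ => mul_nonneg ENNReal.toReal_nonneg (avgDelay_nonneg θ p)]
    refine Finset.sum_congr rfl fun p _ => ?_
    rw [lintegral_pathDelay, ENNReal.ofReal_mul ENNReal.toReal_nonneg,
      ENNReal.ofReal_toReal (plays_ne_top π θ p N)]
  have h2 : 0 ≤ ∑ p, (plays π θ p N).toReal * avgDelay θ p :=
    Finset.sum_nonneg fun p _ => mul_nonneg ENNReal.toReal_nonneg (avgDelay_nonneg θ p)
  rw [regret, h1, EReal.coe_ennreal_ofReal, max_eq_left h2, ← EReal.coe_sub,
    ← sum_toReal_plays π θ N, Finset.sum_mul, ← Finset.sum_sub_distrib]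
  simp_rw [mul_sub]

end Regret

/-! ### Making the divergences finite -/

section Perturbation

open scoped Classical in
/-- Replace by `s` the parameters equal to `1` of the links outside `S`. -/
def perturb (lam : Params E) (S : Finset E) (s : Set.Ioc (0 : ℝ) 1) : Params E :=
  fun i => if i ∉ S ∧ (lam i : ℝ) = 1 then s else lam i

variable (lam : Params E) {S : Finset E} (s : Set.Ioc (0 : ℝ) 1)

omit [Fintype E] in
theorem perturb_of_mem {i : E} (hi : i ∈ S) : perturb lam S s i = lam i := by
  simp [perturb, hi]

omit [Fintype E] in
theorem perturb_lt_one {i : E} (hi : i ∉ S) (hs : (s : ℝ) < 1) :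
    (perturb lam S s i : ℝ) < 1 := by
  by_cases h1 : (lam i : ℝ) = 1
  · simpa [perturb, hi, h1] using hs
  · simpa [perturb, hi, h1] using lt_of_le_of_ne (lam i).2.2 h1

omit [Fintype E] in
theorem avgDelay_perturb_le (p : G.Path) :
    avgDelay (perturb lam S s) p ≤ (s : ℝ)⁻¹ * avgDelay lam p := by
  have hs0 := s.2.1
  have hs1 : 1 ≤ (s : ℝ)⁻¹ := (one_le_inv₀ hs0).2 s.2.2
  rw [avgDelay, avgDelay, Finset.mul_sum]
  refine Finset.sum_le_sum fun i _ => ?_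
  have hi := (lam i).2.1
  by_cases h : i ∉ S ∧ (lam i : ℝ) = 1
  · simp [perturb, h]
  · rw [perturb, if_neg h]
    exact le_mul_of_one_le_left (by positivity) hs1

omit [Fintype E] in
theorem avgDelay_perturb_self (p : G.Path) :
    avgDelay (perturb lam p.links s) p = avgDelay lam p :=
  Finset.sum_congr rfl fun i hi => by rw [perturb_of_mem lam s hi]

-- A replaced link had deterministic delay `1`, an outcome that keeps probability `s`; this
-- domination drives `klDiv_perturb_le`.
omit [Fintype E] in
theorem smul_linkDelay_le_perturb (i : E) :
    ENNReal.ofReal s • linkDelay (lam i) ≤ linkDelay (perturb lam S s i) := by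
  by_cases h : i ∉ S ∧ (lam i : ℝ) = 1
  · rw [perturb, if_pos h, linkDelay_one h.2]
    exact smul_dirac_le_linkDelay s
  · rw [perturb, if_neg h]
    refine Measure.le_iff.2 fun t _ => ?_
    rw [Measure.smul_apply, smul_eq_mul]
    exact mul_le_of_le_one_left zero_le (ENNReal.ofReal_le_one.2 s.2.2)

variable {lam s}

/-- The path `p` has a link off `p⋆`, whose perturbed parameter is below `1`; this gives the delay a
geometric tail. -/
theorem klDiv_perturb_ne_top (θ : Params E) {p pstar : G.Path} (hp : p ≠ pstar)
    (hs : (s : ℝ) < 1) :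
    klDiv (pathDelay θ p) (pathDelay (perturb lam pstar.links s) p) ≠ ∞ := by
  obtain ⟨i, hi, hi'⟩ := Path.exists_link_notMem hp
  exact klDiv_linksDelay_ne_top θ _ hi (perturb_lt_one lam s hi' hs)

theorem klDiv_perturb_le (θ : Params E) {p pstar : G.Path} (hp : p ≠ pstar) (hs : (s : ℝ) < 1) :
    klDiv (pathDelay θ p) (pathDelay (perturb lam pstar.links s) p) ≤
      klDiv (pathDelay θ p) (pathDelay lam p) +
        ENNReal.ofReal (p.links.card * -Real.log s) := by
  have h := klDiv_le_add_of_mul_le (μ := pathDelay θ p) (ν := pathDelay lam p)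
    (pow_pos s.2.1 p.links.card) (fun k => ?_) (klDiv_perturb_ne_top (lam := lam) θ hp hs)
  · rwa [Real.log_pow, ← mul_neg] at h
  · rw [ENNReal.ofReal_pow s.2.1.le]
    exact smul_linksDelay_le p.links (fun i _ => smul_linkDelay_le_perturb lam s i) {k}

theorem klDiv_perturb_self {θ : Params E} {pstar : G.Path}
    (h : pstar.links.val.map lam = pstar.links.val.map θ) :
    klDiv (pathDelay θ pstar) (pathDelay (perturb lam pstar.links s) pstar) = 0 := by
  have h1 : pathDelay θ pstar = pathDelay (perturb lam pstar.links s) pstar := by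
    refine linksDelay_eq_of_map_eq ?_
    rw [← h]
    exact Multiset.map_congr rfl fun i hi => (perturb_of_mem lam s hi).symm
  rw [h1, klDiv_self]

end Perturbation

open scoped Classical in
/-- A limit point of the normalized numbers of selections is feasible. -/
theorem UniformlyGood.feasible_of_tendsto {π : G.BanditPolicy} (hπ : UniformlyGood π)
    {θ : Params E} {pstar : G.Path} (hstar : ∀ p, p ≠ pstar → IsSuboptimal θ p)
    {x : G.Path → ℝ≥0} {φ : ℕ → ℕ} (hφ : Tendsto φ atTop atTop)
    (hx : ∀ p, p ≠ pstar →
      Tendsto (fun n => (plays π θ p (φ n)).toReal / Real.log (φ n)) atTop (nhds (x p))) :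
    Feasible θ pstar x := by
  have hlog : Tendsto (fun n => Real.log (φ n)) atTop atTop :=
    Real.tendsto_log_atTop.comp (tendsto_natCast_atTop_atTop.comp hφ)
  refine le_iInf₂ fun lam hlam => ?_
  obtain ⟨hmap, p₀, hp₀⟩ := hlam
  refine ENNReal.le_of_forall_pos_le_add fun δ hδ _ => ?_
  set K : ℝ := ∑ p ∈ Finset.univ.erase pstar, (x p : ℝ) * p.links.card with hK
  -- For `s` close to `1`, `p₀` still beats `p⋆`, and the total increase `K * -log s` of the
  -- weighted divergences is below `δ`.
  have hex : ∀ᶠ s : ℝ in nhdsWithin 1 (Set.Iio 1), s⁻¹ * avgDelay lam p₀ < avgDelay lam pstar ∧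
      K * -Real.log s < δ ∧ 0 < s := by
    have h1 : ContinuousAt (fun s : ℝ => s⁻¹ * avgDelay lam p₀) 1 :=
      (continuousAt_inv₀ one_ne_zero).mul continuousAt_const
    have h2 : ContinuousAt (fun s : ℝ => K * -Real.log s) 1 :=
      continuousAt_const.mul (Real.continuousAt_log one_ne_zero).neg
    refine nhdsWithin_le_nhds ((h1.eventually_lt_const (by simpa using hp₀)).and
      ((h2.eventually_lt_const (by simpa using hδ)).and (lt_mem_nhds one_pos)))
  obtain ⟨s₀, ⟨hs1, hs2, hs3⟩, hs4⟩ := (hex.and self_mem_nhdsWithin).exists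
  have hs4 : s₀ < 1 := hs4
  set s : Set.Ioc (0 : ℝ) 1 := ⟨s₀, hs3, hs4.le⟩
  set lam' := perturb lam pstar.links s with hlam'
  have hsub : IsSuboptimal lam' pstar := by
    refine ⟨p₀, (avgDelay_perturb_le lam s p₀).trans_lt ?_⟩
    rw [hlam', avgDelay_perturb_self]
    exact hs1
  have hfin : ∀ p : G.Path, klDiv (pathDelay θ p) (pathDelay lam' p) ≠ ∞ := by
    intro p
    by_cases hp : p = pstar
    · subst hp
      rw [hlam', klDiv_perturb_self hmap]
      exact ENNReal.zero_ne_top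
    · exact klDiv_perturb_ne_top θ hp hs4
  set kl : G.Path → ℝ := fun p => (klDiv (pathDelay θ p) (pathDelay lam' p)).toReal with hkldef
  have hreal : 1 ≤ ∑ p ∈ Finset.univ.erase pstar, (x p : ℝ) * kl p := by
    refine le_of_forall_pos_sub_le fun α hα => ?_
    have hlow : Tendsto (fun n => (1 - α) - 2 * Real.log 2 / Real.log (φ n)) atTop
        (nhds (1 - α)) := by
      simpa using tendsto_const_nhds.sub (hlog.const_div_atTop (2 * Real.log 2))
    have hup : Tendsto (fun n => ∑ p ∈ Finset.univ.erase pstar,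
        (plays π θ p (φ n)).toReal / Real.log (φ n) * kl p) atTop
        (nhds (∑ p ∈ Finset.univ.erase pstar, (x p : ℝ) * kl p)) :=
      tendsto_finsetSum _ fun p hp => (hx p (Finset.ne_of_mem_erase hp)).mul_const _
    refine le_of_tendsto_of_tendsto hlow hup ?_
    filter_upwards [hφ.eventually (hπ.eventually_le_sum_plays_mul_klDiv hstar hsub hfin hα),
      hlog.eventually_gt_atTop 0] with n hn hn0
    -- The term of `p⋆` must vanish exactly, since no bound on its count divided by `log N` is
    -- available.
    have hkl0 : klDiv (pathDelay θ pstar) (pathDelay lam' pstar) = 0 := klDiv_perturb_self hmap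
    rw [← Finset.add_sum_erase _ _ (Finset.mem_univ pstar), hkl0, ENNReal.toReal_zero, mul_zero,
      zero_add] at hn
    have h1 := div_le_div_of_nonneg_right hn hn0.le
    rw [sub_div, mul_div_cancel_right₀ _ hn0.ne', Finset.sum_div] at h1
    refine h1.trans_eq (Finset.sum_congr rfl fun p _ => ?_)
    rw [div_mul_eq_mul_div]
  calc (1 : ℝ≥0∞) ≤ ENNReal.ofReal (∑ p ∈ Finset.univ.erase pstar, (x p : ℝ) * kl p) := by
        rw [← ENNReal.ofReal_one]; exact ENNReal.ofReal_le_ofReal hreal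
    _ = ∑ p ∈ Finset.univ.erase pstar,
        (x p : ℝ≥0∞) * klDiv (pathDelay θ p) (pathDelay lam' p) := by
        rw [ENNReal.ofReal_sum_of_nonneg (f := fun p => (x p : ℝ) * kl p)
          fun p _ => mul_nonneg (x p).2 ENNReal.toReal_nonneg]
        refine Finset.sum_congr rfl fun p _ => ?_
        rw [ENNReal.ofReal_mul (x p).coe_nonneg, ENNReal.ofReal_coe_nnreal,
          ENNReal.ofReal_toReal (hfin p)]
    _ ≤ ∑ p ∈ Finset.univ.erase pstar, ((x p : ℝ≥0∞) * klDiv (pathDelay θ p) (pathDelay lam p) +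
        ENNReal.ofReal ((x p : ℝ) * p.links.card * -Real.log s)) := by
        refine Finset.sum_le_sum fun p hp => ?_
        refine (mul_le_mul_right (klDiv_perturb_le θ (Finset.ne_of_mem_erase hp) hs4) _).trans_eq ?_
        rw [mul_add, mul_assoc, ENNReal.ofReal_mul (x p).coe_nonneg, ENNReal.ofReal_coe_nnreal]
    _ ≤ _ := by
        rw [Finset.sum_add_distrib, ← ENNReal.ofReal_sum_of_nonneg, ← Finset.sum_mul]
        · refine add_le_add le_rfl ?_
          rw [← ENNReal.ofReal_coe_nnreal (p := δ)]
          exact ENNReal.ofReal_le_ofReal hs2.le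
        · intro p _
          have : 0 ≤ -Real.log s := neg_nonneg.2 (Real.log_nonpos s.2.1.le s.2.2)
          positivity

end Network

end

/-! ### Compactness and conclusion -/

open Network in
theorem theorem1 {V E : Type*} [Fintype E] (G : Network V E)
    (π : G.BanditPolicy) (hπ : Network.UniformlyGood π)
    (θ : Params E) (pstar : G.Path)
    (hstar : ∀ p : G.Path, p ≠ pstar → Network.avgDelay θ pstar < Network.avgDelay θ p) :
    Network.lowerBoundConst θ pstar ≤
      Filter.liminf (fun N : ℕ => Network.regret π θ pstar N / ((Real.log N : ℝ) : EReal))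
        Filter.atTop := by
  classical
  by_contra! hlt
  obtain ⟨c, hc1, hc2⟩ := EReal.lt_iff_exists_real_btwn.1 hlt
  set Δ : G.Path → ℝ := fun p => avgDelay θ p - avgDelay θ pstar with hΔ
  have hΔ0 : ∀ p, 0 ≤ Δ p := fun p => by
    by_cases hp : p = pstar
    · simp [hΔ, hp]
    · exact (sub_pos.2 (hstar p hp)).le
  -- The coordinate of `p⋆` is set to `0`: it costs nothing and does not enter the constraint, while
  -- the true ratio need not be bounded.
  set y : ℕ → G.Path → ℝ := fun N p =>
    if p = pstar then 0 else (plays π θ p N).toReal / Real.log N with hy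
  have hfreq : ∃ᶠ N : ℕ in atTop, (∀ p, 0 ≤ y N p) ∧ ∑ p, y N p * Δ p ≤ c := by
    refine ((frequently_lt_of_liminf_lt (by isBoundedDefault) hc1).and_eventually
      (eventually_ge_atTop 2)).mono fun N ⟨hN, hN2⟩ => ?_
    have hlog : 0 < Real.log N := Real.log_pos (by exact_mod_cast hN2)
    refine ⟨fun p => ?_, ?_⟩
    · simp only [hy]; split_ifs <;> positivity
    · rw [regret_eq, ← EReal.coe_div, EReal.coe_lt_coe_iff, Finset.sum_div] at hN
      refine le_trans (Finset.sum_le_sum fun p _ => ?_) hN.le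
      by_cases hp : p = pstar
      · simp [hy, hΔ, hp]
      · simp [hy, hΔ, hp, div_mul_eq_mul_div]
  obtain ⟨φ, hφ, hφy⟩ := extraction_of_frequently_atTop hfreq
  -- A regret of at most `c` bounds each coordinate with `Δ p > 0`. At `p⋆` the bound `c / 0` is `0`
  -- by convention, which matches `y`.
  have hmem : ∀ n, y (φ n) ∈ Set.Icc (0 : G.Path → ℝ) (fun p => c / Δ p) := fun n => by
    refine ⟨fun p => (hφy n).1 p, fun p => ?_⟩
    by_cases hp : p = pstar
    · simp [hy, hΔ, hp]
    · refine (le_div_iff₀ (sub_pos.2 (hstar p hp))).2 (le_trans ?_ (hφy n).2)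
      exact Finset.single_le_sum (f := fun p => y (φ n) p * Δ p)
        (fun q _ => mul_nonneg ((hφy n).1 q) (hΔ0 q)) (Finset.mem_univ p)
  obtain ⟨x, hx, ψ, hψ, hlim⟩ := isCompact_Icc.tendsto_subseq hmem
  rw [tendsto_pi_nhds] at hlim
  have hfeas : Feasible θ pstar fun p => ⟨x p, hx.1 p⟩ := by
    refine hπ.feasible_of_tendsto (fun p hp => ⟨pstar, hstar p hp⟩)
      (hφ.comp hψ).tendsto_atTop fun p hp => ?_
    refine (hlim p).congr fun n => ?_
    simp [hy, hp]
  have hle : ∑ p, x p * Δ p ≤ c :=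
    le_of_tendsto (tendsto_finsetSum _ fun p _ => (hlim p).mul_const (Δ p))
      (Eventually.of_forall fun n => (hφy (ψ n)).2)
  have : lowerBoundConst θ pstar ≤ (c : EReal) :=
    (iInf₂_le (fun p => (⟨x p, hx.1 p⟩ : ℝ≥0)) hfeas).trans (EReal.coe_le_coe_iff.2 hle)
  exact absurd hc2 (not_lt.2 this)
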